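/- Let $r\ge 2$ and let $F_r$ be the free group of rank $r$. Let $K_r^3(r)$ be the kernel of a homomorphism $\psi\colon F_r\times F_r\times F_r\to\mathbb{Z}^r$ whose restriction to each of the three factors is surjective (the isomorphism type of the kernel does not depend on the choice of $\psi$). Then $K_r^3(r)$ is finitely presented, and its Dehn function is bounded below by $N^4$; that is, for every such $\psi$ and every finite presentation $\langle S\mid\mathcal R\rangle$ of $\ker\psi$ there is an integer $C>0$ such that \[ N^4\le C\,\delta(CN+C)+CN+C\qquad\text{for all } N\in\mathbb{N}. \] Here $\delta(N)$ is the maximum of $\mathrm{Area}_{\mathcal R}(w)$ over all reduced words $w\in F(S)$ of length at most $N$ that represent the identity of $\ker\psi$, and $\mathrm{Area}_{\mathcal R}(w)$ is the least $M$ such that $w$ is, in $F(S)$, a product of $M$ conjugates of elements of $\mathcal R\cup\mathcal R^{-1}$. -/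

import Mathlib

/-- The area of an element `w` of a free group with respect to a set `R` of relators: the least
number `M` of factors in an expression of `w` as a product of conjugates `u⁻¹ * ρ * u` with
`ρ ∈ R ∪ R⁻¹`. It is `⊤` if there is no such expression, that is, if `w` is not in the normal
closure of `R`. -/
noncomputable def relatorArea {α : Type*} (R : Set (FreeGroup α)) (w : FreeGroup α) : ℕ∞ :=
  sInf {M : ℕ∞ | ∃ L : List (FreeGroup α),
    (∀ g ∈ L, ∃ u : FreeGroup α, ∃ ρ ∈ R, g = u⁻¹ * ρ * u ∨ g = u⁻¹ * ρ⁻¹ * u) ∧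
    L.prod = w ∧ M = (L.length : ℕ∞)}

/-- A finite presentation of a group `G`: finitely many elements that generate `G`, and a finite set
of words in them whose normal closure is the group of all words that are trivial in `G`. -/
structure FiniteGroupPresentation (G : Type*) [Group G] where
  /-- the number of generators -/
  rank : ℕ
  /-- the generators -/
  gen : Fin rank → G
  /-- the relators -/
  rels : Set (FreeGroup (Fin rank))
  finite_rels : rels.Finite
  surjective_lift : Function.Surjective (FreeGroup.lift gen)
  normalClosure_rels : Subgroup.normalClosure rels = (FreeGroup.lift gen).ker

/-- The Dehn function of a finite presentation: the largest area of a word of length at most `N`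
that is trivial in the group. -/
noncomputable def FiniteGroupPresentation.dehn {G : Type*} [Group G]
    (P : FiniteGroupPresentation G) (N : ℕ) : ℕ :=
  sSup {A : ℕ | ∃ w : FreeGroup (Fin P.rank),
    w.norm ≤ N ∧ FreeGroup.lift P.gen w = 1 ∧ relatorArea P.rels w = (A : ℕ∞)}

/-- The relation `f ≼ g` by which Dehn functions are compared. -/
def AsympLE (f g : ℕ → ℕ) : Prop :=
  ∃ C : ℕ, 0 < C ∧ ∀ N : ℕ, f N ≤ C * g (C * N + C) + C * N + C

/-- A homomorphism from the direct product of `n` free groups of rank `m` to `ℤ ^ r` is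
factorwise surjective if its restriction to each factor is surjective. For `m = r` its kernel is
the group `K_r^n(r)`. -/
def FactorwiseSurjective {n m r : ℕ}
    (ψ : (Fin n → FreeGroup (Fin m)) →* Multiplicative (Fin r → ℤ)) : Prop :=
  ∀ i : Fin n, Function.Surjective
    (ψ.comp (MonoidHom.mulSingle (fun _ : Fin n => FreeGroup (Fin m)) i))

/-! Lower bound. A 2-cocycle `c` on a group defines a central extension by ℤ. A null-homotopic word
lifts into the central fibre, where each conjugate of a relator contributes a bounded amount, so the
fibre value (`charge`) is at most a constant times the area (`exists_charge_le_area`). If `u` and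
`v` commute in the group, `⁅u, v⁆` has charge `c(u, v) - c(v, u)`. In `ker ψ` take `u` and `v` to be
commutators of `n`-th powers that live in the first and in the third factor only. They commute, have
word length `O(n)`, and each has `xy`-coordinate `n ^ 2`. The cocycle is a polynomial in class-three
nilpotent images of the factors (`triplePairing`); it is closed because the linear coordinates of
the three factors sum to zero on `ker ψ`. Its term `-4 * g₁.xy * h₃.xy` has no mirror image, so the
charge is `-4 * n ^ 4`.

Finite presentation. `K = ker ψ` is a subdirect product of one free factor and the product of the
other two, and the kernel of the first projection is finitely generated. Finitely many relations
give a group over `K` in which the preimages `N` and `M` of the two projection kernels commute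
(`of_subdirect`). The kernel of the map to `K` then embeds in the abelianisation of `M`, a finitely
generated module over a finitely generated commutative ring, so Hilbert's basis theorem makes it
finitely generated as a normal subgroup (`normalClosure_fg_of_central_ker`). -/

open scoped commutatorElement

/-! ### Central extensions and lower bounds for area. -/

/-- An integral 2-cocycle, not necessarily normalised, of a group with trivial coefficients. -/
structure IntTwoCocycle (G : Type*) [Group G] where
  toFun : G → G → ℤ
  cocycle : ∀ g h k, toFun g h + toFun (g * h) k = toFun h k + toFun g (h * k)

namespace IntTwoCocycle

variable {G : Type*} [Group G] (c : IntTwoCocycle G)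

theorem one_left (g : G) : c.toFun 1 g = c.toFun 1 1 := by
  have h := c.cocycle 1 1 g
  simp only [one_mul] at h
  linarith

theorem one_right (g : G) : c.toFun g 1 = c.toFun 1 1 := by
  have h := c.cocycle g 1 1
  simp only [mul_one] at h
  linarith

/-- The central extension of `G` by `ℤ` determined by a 2-cocycle. -/
@[ext]
structure Extension (c : IntTwoCocycle G) where
  base : G
  fibre : ℤ

namespace Extension

variable {c}

instance : Mul c.Extension :=
  ⟨fun u v => ⟨u.base * v.base, u.fibre + v.fibre + c.toFun u.base v.base⟩⟩

instance : One c.Extension := ⟨⟨1, -c.toFun 1 1⟩⟩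

instance : Inv c.Extension :=
  ⟨fun u => ⟨u.base⁻¹, -u.fibre - c.toFun u.base⁻¹ u.base - c.toFun 1 1⟩⟩

@[simp] theorem base_mul (u v : c.Extension) : (u * v).base = u.base * v.base := rfl

@[simp] theorem fibre_mul (u v : c.Extension) :
    (u * v).fibre = u.fibre + v.fibre + c.toFun u.base v.base := rfl

@[simp] theorem base_one : (1 : c.Extension).base = 1 := rfl

@[simp] theorem fibre_one : (1 : c.Extension).fibre = -c.toFun 1 1 := rfl

@[simp] theorem base_inv (u : c.Extension) : u⁻¹.base = u.base⁻¹ := rfl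

@[simp] theorem fibre_inv (u : c.Extension) :
    u⁻¹.fibre = -u.fibre - c.toFun u.base⁻¹ u.base - c.toFun 1 1 := rfl

instance : Group c.Extension :=
  Group.ofLeftAxioms
    (fun u v w => by
      ext
      · simp [mul_assoc]
      · have := c.cocycle u.base v.base w.base
        simp only [fibre_mul, base_mul]
        linarith)
    (fun u => by
      ext
      · simp
      · simp [c.one_left])
    (fun u => by
      ext
      · simp
      · simp only [fibre_mul, fibre_inv, base_inv, fibre_one]
        ring)

/-- The projection of the extension to its base. -/
def proj (c : IntTwoCocycle G) : c.Extension →* G where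
  toFun := base
  map_one' := rfl
  map_mul' _ _ := rfl

/-- The fibre coordinate, normalised so that it is additive on the kernel of the projection. -/
def charge (u : c.Extension) : ℤ := u.fibre + c.toFun 1 1

@[simp] theorem charge_one : (1 : c.Extension).charge = 0 := by simp [charge]

theorem charge_mul {u v : c.Extension} (hu : u.base = 1) :
    (u * v).charge = u.charge + v.charge := by
  simp [charge, hu, c.one_left]
  ring

theorem charge_inv {u : c.Extension} (hu : u.base = 1) : u⁻¹.charge = -u.charge := by
  simp [charge, hu]
  ring

theorem commute_of_base_eq_one {u : c.Extension} (hu : u.base = 1) (v : c.Extension) :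
    u * v = v * u := by
  ext
  · simp [hu]
  · simp [hu, c.one_left, c.one_right]
    ring

theorem conj_eq_of_base_eq_one {u : c.Extension} (hu : u.base = 1) (v : c.Extension) :
    v⁻¹ * u * v = u := by
  rw [mul_assoc, commute_of_base_eq_one hu, inv_mul_cancel_left]

/-- Compare the fibre coordinates in `⁅u, v⁆ * (v * u) = u * v`, where `⁅u, v⁆` is central. -/
theorem charge_commutatorElement {u v : c.Extension} (h : Commute u.base v.base) :
    ⁅u, v⁆.charge = c.toFun u.base v.base - c.toFun v.base u.base := by
  have hb : ⁅u, v⁆.base = 1 := by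
    have : (proj c ⁅u, v⁆) = 1 := by
      rw [map_commutatorElement, commutatorElement_eq_one_iff_mul_comm]
      exact h
    exact this
  have e : ⁅u, v⁆ * (v * u) = u * v := by simp [commutatorElement_def, mul_assoc]
  have := congrArg charge e
  rw [charge_mul hb] at this
  simp only [charge, fibre_mul] at this ⊢
  linarith

end Extension

open Extension in
/-- A 2-cocycle bounds the area of null-homotopic words from below. -/
theorem exists_charge_le_area (P : FiniteGroupPresentation G) :
    ∃ (φ : FreeGroup (Fin P.rank) →* c.Extension) (B : ℕ),
      (∀ w, (φ w).base = FreeGroup.lift P.gen w) ∧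
      ∀ (w : FreeGroup (Fin P.rank)) (A : ℕ), relatorArea P.rels w = (A : ℕ∞) →
        (φ w).charge.natAbs ≤ B * A := by
  set φ : FreeGroup (Fin P.rank) →* c.Extension :=
    FreeGroup.lift fun j => ⟨P.gen j, 0⟩ with hφ
  have hbase : ∀ w, (φ w).base = FreeGroup.lift P.gen w := by
    have : (proj c).comp φ = FreeGroup.lift P.gen := by
      ext j
      simp [hφ, proj]
    exact fun w => DFunLike.congr_fun this w
  have hrel : ∀ ρ ∈ P.rels, (φ ρ).base = 1 := fun ρ hρ => by
    rw [hbase, ← MonoidHom.mem_ker, ← P.normalClosure_rels]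
    exact Subgroup.subset_normalClosure hρ
  -- `B` is the largest charge of a relator; conjugation does not change a charge, since the kernel
  -- of the projection is central.
  obtain ⟨B, hB⟩ := (P.finite_rels.image fun ρ => (φ ρ).charge.natAbs).bddAbove
  refine ⟨φ, B, hbase, fun w A hA => ?_⟩
  have hL : ∀ L : List (FreeGroup (Fin P.rank)),
      (∀ g ∈ L, ∃ u : FreeGroup (Fin P.rank), ∃ ρ ∈ P.rels,
        g = u⁻¹ * ρ * u ∨ g = u⁻¹ * ρ⁻¹ * u) →
      (φ L.prod).charge.natAbs ≤ B * L.length := by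
    intro L
    induction L with
    | nil => simp
    | cons g L ih =>
      intro h
      obtain ⟨u, ρ, hρ, hg⟩ := h g (by simp)
      have h1 := ih fun g' hg' => h g' (by simp [hg'])
      have hb := hrel ρ hρ
      have hb' : (φ ρ)⁻¹.base = 1 := by simp [hb]
      have h2 : (φ ρ).charge.natAbs ≤ B := hB ⟨ρ, hρ, rfl⟩
      have h3 : (φ g).base = 1 ∧ (φ g).charge.natAbs ≤ B := by
        rcases hg with rfl | rfl
        · rw [map_mul, map_mul, map_inv, conj_eq_of_base_eq_one hb]
          exact ⟨hb, h2⟩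
        · rw [map_mul, map_mul, map_inv, map_inv, conj_eq_of_base_eq_one hb', charge_inv hb,
            Int.natAbs_neg]
          exact ⟨hb', h2⟩
      rw [List.prod_cons, map_mul, charge_mul h3.1, List.length_cons, mul_add, mul_one]
      have := Int.natAbs_add_le (φ g).charge (φ L.prod).charge
      omega
  have hmem : relatorArea P.rels w ∈ {M : ℕ∞ | ∃ L : List (FreeGroup (Fin P.rank)),
      (∀ g ∈ L, ∃ u : FreeGroup (Fin P.rank), ∃ ρ ∈ P.rels,
        g = u⁻¹ * ρ * u ∨ g = u⁻¹ * ρ⁻¹ * u) ∧ L.prod = w ∧ M = (L.length : ℕ∞)} := by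
    -- The infimum is attained: the set is nonempty because otherwise the area would be `⊤`.
    refine csInf_mem (Set.nonempty_iff_ne_empty.2 fun h => ?_)
    rw [relatorArea, h, sInf_empty] at hA
    exact ENat.natCast_ne_top A hA.symm
  obtain ⟨L, h1, rfl, h3⟩ := hmem
  rw [hA, Nat.cast_inj] at h3
  rw [h3]
  exact hL L h1

end IntTwoCocycle

/-! ### Finiteness of areas, word lengths and the Dehn function. -/

theorem exists_relatorArea_eq {α : Type*} {R : Set (FreeGroup α)} {w : FreeGroup α}
    (hw : w ∈ Subgroup.normalClosure R) : ∃ A : ℕ, relatorArea R w = (A : ℕ∞) := by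
  suffices h : ∃ L : List (FreeGroup α),
      (∀ g ∈ L, ∃ u : FreeGroup α, ∃ ρ ∈ R, g = u⁻¹ * ρ * u ∨ g = u⁻¹ * ρ⁻¹ * u) ∧
      L.prod = w by
    obtain ⟨L, h1, h2⟩ := h
    have : relatorArea R w ≤ (L.length : ℕ∞) := sInf_le ⟨L, h1, h2, rfl⟩
    obtain ⟨A, hA⟩ := ENat.ne_top_iff_exists.1 (ne_top_of_le_ne_top (ENat.natCast_ne_top _) this)
    exact ⟨A, hA.symm⟩
  induction hw using Subgroup.closure_induction with
  | mem x hx =>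
    obtain ⟨ρ, hρ, hx⟩ := Group.mem_conjugatesOfSet_iff.1 hx
    obtain ⟨u, rfl⟩ := isConj_iff.1 hx
    exact ⟨[u * ρ * u⁻¹], by
      simpa using ⟨u⁻¹, ρ, hρ, Or.inl (by simp)⟩, by simp⟩
  | one => exact ⟨[], by simp, rfl⟩
  | mul x y _ _ hx hy =>
    obtain ⟨L, h1, rfl⟩ := hx
    obtain ⟨L', h1', rfl⟩ := hy
    refine ⟨L ++ L', fun g hg => ?_, by simp⟩
    rcases List.mem_append.1 hg with h | h
    exacts [h1 g h, h1' g h]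
  | inv x _ hx =>
    obtain ⟨L, h1, rfl⟩ := hx
    refine ⟨(L.map (·⁻¹)).reverse, fun g hg => ?_, (List.prod_inv_reverse L).symm⟩
    simp only [List.mem_reverse, List.mem_map] at hg
    obtain ⟨g', hg', rfl⟩ := hg
    obtain ⟨u, ρ, hρ, h | h⟩ := h1 g' hg'
    · exact ⟨u, ρ, hρ, Or.inr (by rw [h]; group)⟩
    · exact ⟨u, ρ, hρ, Or.inl (by rw [h]; group)⟩

theorem FreeGroup.finite_norm_le {α : Type*} [Finite α] [DecidableEq α] (N : ℕ) :
    {w : FreeGroup α | w.norm ≤ N}.Finite :=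
  Set.Finite.of_finite_image
    ((List.finite_length_le (α × Bool) N).subset (by rintro _ ⟨w, hw, rfl⟩; exact hw))
    FreeGroup.toWord_injective.injOn

theorem FreeGroup.norm_pow_le {α : Type*} [DecidableEq α] (w : FreeGroup α) (n : ℕ) :
    (w ^ n).norm ≤ n * w.norm := by
  induction n with
  | zero => simp
  | succ n ih =>
    rw [pow_succ, add_mul, one_mul]
    exact (FreeGroup.norm_mul_le _ _).trans (by omega)

theorem FreeGroup.norm_commutatorElement_le {α : Type*} [DecidableEq α] (u v : FreeGroup α) :
    ⁅u, v⁆.norm ≤ 2 * (u.norm + v.norm) := by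
  have h1 := FreeGroup.norm_mul_le (u * v * u⁻¹) v⁻¹
  have h2 := FreeGroup.norm_mul_le (u * v) u⁻¹
  have h3 := FreeGroup.norm_mul_le u v
  rw [FreeGroup.norm_inv_eq] at h1 h2
  rw [commutatorElement_def]
  omega

theorem FiniteGroupPresentation.le_dehn {G : Type*} [Group G] (P : FiniteGroupPresentation G)
    {N A : ℕ} {w : FreeGroup (Fin P.rank)} (hN : w.norm ≤ N) (hw : FreeGroup.lift P.gen w = 1)
    (hA : relatorArea P.rels w = (A : ℕ∞)) : A ≤ P.dehn N := by
  refine le_csSup ?_ ⟨w, hN, hw, hA⟩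
  -- Boundedness matters: `sSup` of an unbounded set of naturals is `0`.
  refine (((FreeGroup.finite_norm_le N).image
    fun w => (relatorArea P.rels w).toNat).subset ?_).bddAbove
  rintro A ⟨w, h1, -, h3⟩
  exact ⟨w, h1, by simp [h3]⟩

/-- A quartic lower bound for the Dehn function from a 2-cocycle that is quartic on the commutators
of two commuting families of commutators of powers. -/
theorem IntTwoCocycle.asympLE_dehn {G : Type*} [Group G] (c : IntTwoCocycle G) (a b a' b' : G)
    (hcomm : ∀ n : ℕ, Commute ⁅a ^ n, b ^ n⁆ ⁅a' ^ n, b' ^ n⁆)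
    (hc : ∀ n : ℕ, n ^ 4 ≤ (c.toFun ⁅a ^ n, b ^ n⁆ ⁅a' ^ n, b' ^ n⁆ -
      c.toFun ⁅a' ^ n, b' ^ n⁆ ⁅a ^ n, b ^ n⁆).natAbs)
    (P : FiniteGroupPresentation G) : AsympLE (fun N => N ^ 4) P.dehn := by
  obtain ⟨φ, B, hφ, hB⟩ := c.exists_charge_le_area P
  obtain ⟨wa, rfl⟩ := P.surjective_lift a
  obtain ⟨wb, rfl⟩ := P.surjective_lift b
  obtain ⟨wa', rfl⟩ := P.surjective_lift a'
  obtain ⟨wb', rfl⟩ := P.surjective_lift b'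
  set l := 4 * (wa.norm + wb.norm + wa'.norm + wb'.norm) with hl
  -- `l * n` bounds the length of the word `⁅u, v⁆`, `B` is the charge per relator, and `1` ensures
  -- positivity.
  refine ⟨l + B + 1, by omega, fun n => ?_⟩
  set u := ⁅wa ^ n, wb ^ n⁆ with hu
  set v := ⁅wa' ^ n, wb' ^ n⁆ with hv
  have hlu : FreeGroup.lift P.gen u =
      ⁅FreeGroup.lift P.gen wa ^ n, FreeGroup.lift P.gen wb ^ n⁆ := by
    rw [hu, map_commutatorElement, map_pow, map_pow]
  have hlv : FreeGroup.lift P.gen v =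
      ⁅FreeGroup.lift P.gen wa' ^ n, FreeGroup.lift P.gen wb' ^ n⁆ := by
    rw [hv, map_commutatorElement, map_pow, map_pow]
  have hw : FreeGroup.lift P.gen ⁅u, v⁆ = 1 := by
    rw [map_commutatorElement, commutatorElement_eq_one_iff_mul_comm, hlu, hlv]
    exact hcomm n
  have hnorm : ⁅u, v⁆.norm ≤ (l + B + 1) * n + (l + B + 1) := by
    have h0 := FreeGroup.norm_commutatorElement_le u v
    have h1 := FreeGroup.norm_commutatorElement_le (wa ^ n) (wb ^ n)
    have h2 := FreeGroup.norm_commutatorElement_le (wa' ^ n) (wb' ^ n)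
    have h3 := FreeGroup.norm_pow_le wa n
    have h4 := FreeGroup.norm_pow_le wb n
    have h5 := FreeGroup.norm_pow_le wa' n
    have h6 := FreeGroup.norm_pow_le wb' n
    have : l * n = 4 * (n * wa.norm + n * wb.norm + n * wa'.norm + n * wb'.norm) := by
      rw [hl]; ring
    rw [← hu] at h1
    rw [← hv] at h2
    nlinarith
  obtain ⟨A, hA⟩ := exists_relatorArea_eq (R := P.rels) (w := ⁅u, v⁆)
    (by rw [P.normalClosure_rels]; exact hw)
  have h1 := P.le_dehn hnorm hw hA
  have h2 := hB _ A hA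
  rw [map_commutatorElement, Extension.charge_commutatorElement, hφ, hφ, hlu, hlv] at h2
  · have h3 := (hc n).trans h2
    calc n ^ 4 ≤ B * A := h3
      _ ≤ (l + B + 1) * P.dehn ((l + B + 1) * n + (l + B + 1)) :=
        Nat.mul_le_mul (by omega) h1
      _ ≤ _ := by omega
  · rw [hφ, hφ, hlu, hlv]
    exact hcomm n

/-! ### The nilpotent group and its polynomial cocycle. -/

/-- A nilpotent group of class three on `ℤ ^ 5`. Its coordinates are, up to factors, iterated sums
of the increments of a path in the plane. -/
@[ext]
structure IteratedSums where
  x : ℤ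
  y : ℤ
  xy : ℤ
  xxy : ℤ
  xyy : ℤ

namespace IteratedSums

instance : Mul IteratedSums :=
  ⟨fun g h => ⟨g.x + h.x, g.y + h.y, g.xy + h.xy + g.x * h.y,
    g.xxy + h.xxy + 2 * g.x * h.xy + g.x ^ 2 * h.y,
    g.xyy + h.xyy + 2 * g.xy * h.y + g.x * h.y ^ 2⟩⟩

instance : One IteratedSums := ⟨⟨0, 0, 0, 0, 0⟩⟩

instance : Inv IteratedSums :=
  ⟨fun g => ⟨-g.x, -g.y, -g.xy + g.x * g.y, -g.xxy + 2 * g.x * g.xy - g.x ^ 2 * g.y,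
    -g.xyy + 2 * g.xy * g.y - g.x * g.y ^ 2⟩⟩

@[simp] theorem mul_x (g h : IteratedSums) : (g * h).x = g.x + h.x := rfl
@[simp] theorem mul_y (g h : IteratedSums) : (g * h).y = g.y + h.y := rfl
@[simp] theorem mul_xy (g h : IteratedSums) : (g * h).xy = g.xy + h.xy + g.x * h.y := rfl
@[simp] theorem mul_xxy (g h : IteratedSums) :
    (g * h).xxy = g.xxy + h.xxy + 2 * g.x * h.xy + g.x ^ 2 * h.y := rfl
@[simp] theorem mul_xyy (g h : IteratedSums) :
    (g * h).xyy = g.xyy + h.xyy + 2 * g.xy * h.y + g.x * h.y ^ 2 := rfl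
@[simp] theorem one_x : (1 : IteratedSums).x = 0 := rfl
@[simp] theorem one_y : (1 : IteratedSums).y = 0 := rfl
@[simp] theorem one_xy : (1 : IteratedSums).xy = 0 := rfl
@[simp] theorem one_xxy : (1 : IteratedSums).xxy = 0 := rfl
@[simp] theorem one_xyy : (1 : IteratedSums).xyy = 0 := rfl
@[simp] theorem inv_x (g : IteratedSums) : g⁻¹.x = -g.x := rfl
@[simp] theorem inv_y (g : IteratedSums) : g⁻¹.y = -g.y := rfl
@[simp] theorem inv_xy (g : IteratedSums) : g⁻¹.xy = -g.xy + g.x * g.y := rfl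
@[simp] theorem inv_xxy (g : IteratedSums) :
    g⁻¹.xxy = -g.xxy + 2 * g.x * g.xy - g.x ^ 2 * g.y := rfl
@[simp] theorem inv_xyy (g : IteratedSums) :
    g⁻¹.xyy = -g.xyy + 2 * g.xy * g.y - g.x * g.y ^ 2 := rfl

instance : Group IteratedSums :=
  Group.ofLeftAxioms
    (fun _ _ _ => by ext <;> simp <;> ring)
    (fun _ => by ext <;> simp)
    (fun _ => by ext <;> simp <;> ring)

/-- The projection to the two linear coordinates. -/
def linear : IteratedSums →* Multiplicative (ℤ × ℤ) where
  toFun g := Multiplicative.ofAdd (g.x, g.y)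
  map_one' := rfl
  map_mul' _ _ := rfl

theorem pow_x (g : IteratedSums) (n : ℕ) : (g ^ n).x = n * g.x := by
  induction n with
  | zero => simp
  | succ n ih => rw [pow_succ, mul_x, ih]; push_cast; ring

theorem pow_y (g : IteratedSums) (n : ℕ) : (g ^ n).y = n * g.y := by
  induction n with
  | zero => simp
  | succ n ih => rw [pow_succ, mul_y, ih]; push_cast; ring

theorem commutatorElement_x (g h : IteratedSums) : ⁅g, h⁆.x = 0 := by
  simp [commutatorElement_def]

theorem commutatorElement_y (g h : IteratedSums) : ⁅g, h⁆.y = 0 := by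
  simp [commutatorElement_def]

theorem commutatorElement_xy (g h : IteratedSums) : ⁅g, h⁆.xy = g.x * h.y - h.x * g.y := by
  simp [commutatorElement_def]
  ring

/-- A polynomial in the coordinates of two triples of elements, which is a 2-cocycle on the triples
whose linear coordinates sum to zero. -/
def triplePairing (g₁ g₂ g₃ h₁ h₂ h₃ : IteratedSums) : ℤ :=
  -2 * g₁.x * h₁.xyy + 2 * g₁.x * h₂.xyy + 2 * g₂.x * h₂.xyy + 2 * g₂.x * h₃.xyy
  + 4 * g₁.xy * h₁.xy + 2 * g₁.xy * h₂.xy - 4 * g₁.xy * h₃.xy - 2 * g₂.xy * h₁.xy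
  - 2 * g₂.xy * h₂.xy + 2 * g₂.xy * h₃.xy - 2 * g₃.xy * h₂.xy + 2 * g₃.xy * h₃.xy
  + 2 * g₁.xxy * h₂.y - 2 * g₂.xxy * h₁.y + 2 * g₃.xxy * h₁.y + 2 * g₁.xyy * h₂.x
  + 4 * g₁.x * h₁.y * h₁.xy - 2 * g₁.x * h₁.y * h₃.xy - 2 * g₁.x * h₂.y * h₂.xy
  + 2 * g₁.x * h₂.y * h₃.xy - 4 * g₁.x * g₁.xy * h₂.y + 2 * g₁.x * g₂.xy * h₂.y
  + 2 * g₁.x * g₃.xy * h₁.y + 2 * g₁.x * g₃.xy * h₂.y - 2 * g₂.x * h₁.y * h₂.xy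
  + 2 * g₂.x * h₁.y * h₃.xy - 2 * g₂.x * h₂.y * h₁.xy - 4 * g₂.x * h₂.y * h₂.xy
  + 4 * g₂.x * h₂.y * h₃.xy - 2 * g₂.x * g₁.xy * h₂.y + 2 * g₂.x * g₂.xy * h₁.y
  + 2 * g₂.x * g₃.xy * h₁.y + 4 * g₁.xy * h₂.x * h₁.y + 2 * g₁.x * h₂.x * h₁.y ^ 2
  + g₁.x ^ 2 * h₂.y ^ 2 + 2 * g₁.x * g₂.x * h₂.y ^ 2

/-- Eliminating third linear coordinates through the constraints leaves a polynomial identity in the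
remaining coordinates. -/
theorem triplePairing_cocycle (g₁ g₂ g₃ h₁ h₂ h₃ k₁ k₂ k₃ : IteratedSums)
    (hgx : g₃.x = -g₁.x - g₂.x)
    (hhx : h₃.x = -h₁.x - h₂.x) (hhy : h₃.y = -h₁.y - h₂.y)
    (hky : k₃.y = -k₁.y - k₂.y) :
    triplePairing g₁ g₂ g₃ h₁ h₂ h₃ +
        triplePairing (g₁ * h₁) (g₂ * h₂) (g₃ * h₃) k₁ k₂ k₃ =
      triplePairing h₁ h₂ h₃ k₁ k₂ k₃ +
        triplePairing g₁ g₂ g₃ (h₁ * k₁) (h₂ * k₂) (h₃ * k₃) := by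
  simp only [triplePairing, mul_x, mul_y, mul_xy, mul_xxy, mul_xyy, hgx, hhx, hhy, hky]
  ring

end IteratedSums

/-! ### The cocycle on `ker ψ` and the quartic lower bound. -/

open Multiplicative

section

variable {r : ℕ} (ψ : (Fin 3 → FreeGroup (Fin r)) →* Multiplicative (Fin r → ℤ))

/-- The lift to `IteratedSums` of the `i`-th and `j`-th coordinates of the restriction of `ψ` to a
factor. -/
def factorIteratedSums (i j : Fin r) (k : Fin 3) : FreeGroup (Fin r) →* IteratedSums :=
  FreeGroup.lift fun l =>
    ⟨toAdd (ψ (Pi.mulSingle k (FreeGroup.of l))) i,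
      toAdd (ψ (Pi.mulSingle k (FreeGroup.of l))) j, 0, 0, 0⟩

theorem factorIteratedSums_linear (i j : Fin r) (k : Fin 3) (g : FreeGroup (Fin r)) :
    (factorIteratedSums ψ i j k g).x = toAdd (ψ (Pi.mulSingle k g)) i ∧
      (factorIteratedSums ψ i j k g).y = toAdd (ψ (Pi.mulSingle k g)) j := by
  have h : IteratedSums.linear.comp (factorIteratedSums ψ i j k) =
      (AddMonoidHom.toMultiplicative
        ((Pi.evalAddMonoidHom (fun _ : Fin r => ℤ) i).prod
          (Pi.evalAddMonoidHom (fun _ : Fin r => ℤ) j))).comp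
        (ψ.comp (MonoidHom.mulSingle (fun _ : Fin 3 => FreeGroup (Fin r)) k)) := by
    ext l
    · simp [factorIteratedSums, IteratedSums.linear]
    · simp [factorIteratedSums, IteratedSums.linear]
  have := congrArg toAdd (DFunLike.congr_fun h g)
  exact ⟨congrArg Prod.fst this, congrArg Prod.snd this⟩

theorem eq_mulSingle_mul_mulSingle_mul_mulSingle {H : Type*} [Group H] (g : Fin 3 → H) :
    g = Pi.mulSingle 0 (g 0) * Pi.mulSingle 1 (g 1) * Pi.mulSingle 2 (g 2) := by
  ext k
  fin_cases k <;> simp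

variable {ψ} in
theorem factorIteratedSums_eq_of_mem_ker (i j : Fin r) {g : Fin 3 → FreeGroup (Fin r)}
    (hg : g ∈ ψ.ker) :
    (factorIteratedSums ψ i j 2 (g 2)).x =
        -(factorIteratedSums ψ i j 0 (g 0)).x - (factorIteratedSums ψ i j 1 (g 1)).x ∧
      (factorIteratedSums ψ i j 2 (g 2)).y =
        -(factorIteratedSums ψ i j 0 (g 0)).y - (factorIteratedSums ψ i j 1 (g 1)).y := by
  have h := hg
  rw [MonoidHom.mem_ker, eq_mulSingle_mul_mulSingle_mul_mulSingle g, map_mul, map_mul] at h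
  have hi := congrFun (congrArg toAdd h) i
  have hj := congrFun (congrArg toAdd h) j
  simp only [toAdd_mul, toAdd_one, Pi.add_apply, Pi.zero_apply] at hi hj
  simp only [factorIteratedSums_linear]
  constructor <;> linarith

/-- The 2-cocycle on the kernel of `ψ` induced by `IteratedSums.triplePairing`. -/
def kerCocycle (i j : Fin r) : IntTwoCocycle ψ.ker where
  toFun g h := IteratedSums.triplePairing
    (factorIteratedSums ψ i j 0 (g.1 0)) (factorIteratedSums ψ i j 1 (g.1 1))
    (factorIteratedSums ψ i j 2 (g.1 2)) (factorIteratedSums ψ i j 0 (h.1 0))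
    (factorIteratedSums ψ i j 1 (h.1 1)) (factorIteratedSums ψ i j 2 (h.1 2))
  cocycle g h k := by
    have hg := factorIteratedSums_eq_of_mem_ker i j g.2
    have hh := factorIteratedSums_eq_of_mem_ker i j h.2
    have hk := factorIteratedSums_eq_of_mem_ker i j k.2
    simp only [Subgroup.coe_mul, Pi.mul_apply, map_mul]
    exact IteratedSums.triplePairing_cocycle _ _ _ _ _ _ _ _ _ hg.1 hh.1 hh.2 hk.2

end

theorem commutatorElement_pow_apply {H : Type*} [Group H] (a b : Fin 3 → H) (n : ℕ)
    (k : Fin 3) : ⁅a ^ n, b ^ n⁆ k = ⁅a k ^ n, b k ^ n⁆ := rfl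

theorem asympLE_dehn_ker {r : ℕ} (hr : 2 ≤ r)
    (ψ : (Fin 3 → FreeGroup (Fin r)) →* Multiplicative (Fin r → ℤ))
    (hψ : FactorwiseSurjective ψ) (P : FiniteGroupPresentation ψ.ker) :
    AsympLE (fun N => N ^ 4) P.dehn := by
  set i : Fin r := ⟨0, by omega⟩ with hi
  set j : Fin r := ⟨1, by omega⟩ with hj
  have hij : i ≠ j := by simp [hi, hj]
  choose α hα using fun k => hψ k (ofAdd (Pi.single i 1))
  choose β hβ using fun k => hψ k (ofAdd (Pi.single j 1))
  simp only [MonoidHom.comp_apply, MonoidHom.mulSingle_apply] at hα hβ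
  have hmem : ∀ (γ : Fin 3 → FreeGroup (Fin r)) (v : Multiplicative (Fin r → ℤ)),
      (∀ k, ψ (Pi.mulSingle k (γ k)) = v) → ∀ k l,
      Pi.mulSingle k (γ k) * (Pi.mulSingle l (γ l))⁻¹ ∈ ψ.ker := by
    intro γ v h k l
    rw [MonoidHom.mem_ker, map_mul, map_inv, h, h, mul_inv_cancel]
  let a (k l : Fin 3) : ψ.ker := ⟨_, hmem α _ hα k l⟩
  let b (k l : Fin 3) : ψ.ker := ⟨_, hmem β _ hβ k l⟩
  -- `a 0 1` is supported on factors 0 and 1 and `b 0 2` on factors 0 and 2, so their commutator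
  -- survives only in the common factor 0.
  have hU : ∀ n : ℕ, ((⁅a 0 1 ^ n, b 0 2 ^ n⁆ : ψ.ker) : Fin 3 → FreeGroup (Fin r)) =
      Pi.mulSingle 0 ⁅α 0 ^ n, β 0 ^ n⁆ := by
    intro n
    change ⁅(a 0 1).1 ^ n, (b 0 2).1 ^ n⁆ = _
    ext k
    rw [commutatorElement_pow_apply]
    fin_cases k <;> simp [a, b]
  have hZ : ∀ n : ℕ, ((⁅a 2 1 ^ n, b 2 0 ^ n⁆ : ψ.ker) : Fin 3 → FreeGroup (Fin r)) =
      Pi.mulSingle 2 ⁅α 2 ^ n, β 2 ^ n⁆ := by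
    intro n
    change ⁅(a 2 1).1 ^ n, (b 2 0).1 ^ n⁆ = _
    ext k
    rw [commutatorElement_pow_apply]
    fin_cases k <;> simp [a, b]
  have hs : ∀ (k : Fin 3) (n : ℕ),
      (factorIteratedSums ψ i j k ⁅α k ^ n, β k ^ n⁆).x = 0 ∧
      (factorIteratedSums ψ i j k ⁅α k ^ n, β k ^ n⁆).y = 0 ∧
      (factorIteratedSums ψ i j k ⁅α k ^ n, β k ^ n⁆).xy = n ^ 2 := by
    intro k n
    rw [map_commutatorElement, map_pow, map_pow]
    refine ⟨IteratedSums.commutatorElement_x _ _, IteratedSums.commutatorElement_y _ _, ?_⟩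
    rw [IteratedSums.commutatorElement_xy]
    simp only [IteratedSums.pow_x, IteratedSums.pow_y, factorIteratedSums_linear, hα, hβ]
    simp [hij, hij.symm]
    ring
  refine (kerCocycle ψ i j).asympLE_dehn (a 0 1) (b 0 2) (a 2 1) (b 2 0) (fun n => ?_)
    (fun n => ?_) P
  · refine Subtype.ext ?_
    rw [Subgroup.coe_mul, Subgroup.coe_mul, hU, hZ]
    exact Pi.mulSingle_commute (by decide) _ _
  · have h0 := hs 0 n
    have h2 := hs 2 n
    have h20 : (2 : Fin 3) ≠ 0 := by decide
    have h21 : (1 : Fin 3) ≠ 2 := by decide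
    -- In the order (factor 0, factor 2) only `-4 * g₁.xy * h₃.xy` survives; in the opposite order
    -- every term vanishes. The unknown `xxy` and `xyy` coordinates occur only multiplied by zeros.
    simp only [kerCocycle, hU, hZ, IteratedSums.triplePairing, Pi.mulSingle_eq_same,
      Pi.mulSingle_eq_of_ne h20, Pi.mulSingle_eq_of_ne h20.symm, Pi.mulSingle_eq_of_ne one_ne_zero,
      Pi.mulSingle_eq_of_ne h21, map_one, h0, h2, IteratedSums.one_x, IteratedSums.one_y,
      IteratedSums.one_xy, IteratedSums.one_xxy, IteratedSums.one_xyy]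
    ring_nf
    simp [Int.natAbs_mul, Int.natAbs_pow]
    omega

/-! ### Finiteness properties of kernels, products and subdirect products. -/

section FinitelyPresented

open Subgroup

/-- A homomorphism from a finitely generated group onto a finitely presented group has a kernel that
is finitely generated as a normal subgroup. -/
theorem Group.IsFinitelyPresented.isFinitelyNormallyGenerated_ker {G Q : Type*} [Group G] [Group Q]
    [Group.FG G] [hQ : Group.IsFinitelyPresented Q] (f : G →* Q) (hf : Function.Surjective f) :
    f.ker.IsFinitelyNormallyGenerated := by
  obtain ⟨n, φ, hφ, S, hS, hSφ⟩ := hQ.out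
  obtain ⟨T, hT, hTfin⟩ := (Group.fg_iff (G := G)).1 inferInstance
  set θ : FreeGroup (Fin n) →* G :=
    FreeGroup.lift fun i => Function.surjInv hf (φ (FreeGroup.of i)) with hθ
  have hfθ : ∀ w, f (θ w) = φ w := by
    have : f.comp θ = φ := by
      ext i
      simp [hθ, Function.surjInv_eq]
    exact fun w => DFunLike.congr_fun this w
  choose w hw using fun t : G => hφ (f t)
  -- The first set carries the relations of `Q`; the second makes every generator of `G` equal to an
  -- element of `θ.range` modulo `R`.
  set R : Set G := θ '' S ∪ (fun t => t⁻¹ * θ (w t)) '' T with hR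
  have hmk : normalClosure R ≤ f.ker := by
    refine normalClosure_le_normal ?_
    rintro _ (⟨s, hs, rfl⟩ | ⟨t, -, rfl⟩)
    · change f (θ s) = 1
      rw [hfθ, ← MonoidHom.mem_ker, ← hSφ]
      exact subset_normalClosure hs
    · change f (t⁻¹ * θ (w t)) = 1
      rw [map_mul, map_inv, hfθ, hw, inv_mul_cancel]
  refine ⟨R, (hS.image _).union (hTfin.image _), le_antisymm hmk ?_⟩
  have htop : θ.range ⊔ normalClosure R = ⊤ := by
    rw [eq_top_iff, ← hT, closure_le]
    intro t ht
    have h1 : t⁻¹ * θ (w t) ∈ normalClosure R :=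
      subset_normalClosure (Or.inr ⟨t, ht, rfl⟩)
    have h2 : t = θ (w t) * (t⁻¹ * θ (w t))⁻¹ := by group
    rw [h2]
    exact mul_mem_sup ⟨_, rfl⟩ (inv_mem h1)
  intro g hg
  obtain ⟨_, ⟨v, rfl⟩, m, hm, rfl⟩ := mem_sup_of_normal_right.1 (htop ▸ mem_top g)
  refine mul_mem ?_ hm
  have hv : v ∈ normalClosure S := by
    rw [hSφ, MonoidHom.mem_ker, ← hfθ]
    rw [MonoidHom.mem_ker, map_mul, (hmk hm : f m = 1), mul_one] at hg
    exact hg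
  exact (normalClosure_le_normal (N := (normalClosure R).comap θ)
    fun s hs => subset_normalClosure (Or.inl ⟨s, hs, rfl⟩)) hv

theorem Subgroup.commute_of_mem_closure {G : Type*} [Group G] {S T : Set G}
    (h : ∀ s ∈ S, ∀ t ∈ T, Commute s t) {x y : G} (hx : x ∈ closure S) (hy : y ∈ closure T) :
    Commute x y := by
  have h1 : T ⊆ centralizer (closure S : Set G) := by
    rw [centralizer_closure]
    intro t ht
    rw [SetLike.mem_coe, mem_centralizer_iff]
    exact fun s hs => h s hs t ht
  exact mem_centralizer_iff.1 (((closure_le _).2 h1) hy) x hx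

instance Group.IsFinitelyPresented.group_fg {G : Type*} [Group G]
    [h : Group.IsFinitelyPresented G] : Group.FG G := by
  obtain ⟨n, φ, hφ, -⟩ := h.out
  exact Group.fg_of_surjective hφ

/-- The product is the free product modulo the finitely many commutators of generators: once
generators of the two sides commute, so do all their elements. -/
instance Group.IsFinitelyPresented.prod {G H : Type*} [Group G] [Group H]
    [Group.IsFinitelyPresented G] [Group.IsFinitelyPresented H] :
    Group.IsFinitelyPresented (G × H) := by
  obtain ⟨S, hS, hSfin⟩ := (Group.fg_iff (G := G)).1 inferInstance
  obtain ⟨T, hT, hTfin⟩ := (Group.fg_iff (G := H)).1 inferInstance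
  let inl : G →* Monoid.Coprod G H := Monoid.Coprod.inl
  let inr : H →* Monoid.Coprod G H := Monoid.Coprod.inr
  set R : Set (Monoid.Coprod G H) := Set.image2 (fun s t => ⁅inl s, inr t⁆) S T with hR
  refine of_surjective (Monoid.Coprod.toProd (M := G) (N := H))
    (fun x => ⟨inl x.1 * inr x.2, by simp [inl, inr]⟩)
    ⟨R, hSfin.image2 _ hTfin, le_antisymm ?_ ?_⟩
  · refine normalClosure_le_normal ?_
    rintro _ ⟨s, -, t, -, rfl⟩
    rw [SetLike.mem_coe, MonoidHom.mem_ker, map_commutatorElement,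
      commutatorElement_eq_one_iff_mul_comm]
    simp [inl, inr]
  · let q := QuotientGroup.mk' (normalClosure R)
    have hcomm : ∀ (g : G) (h : H), Commute ((q.comp inl) g) ((q.comp inr) h) := by
      intro g h
      refine commute_of_mem_closure (S := q.comp inl '' S) (T := q.comp inr '' T) ?_ ?_ ?_
      · rintro _ ⟨s, hs, rfl⟩ _ ⟨t, ht, rfl⟩
        rw [commute_iff_eq, ← commutatorElement_eq_one_iff_mul_comm, MonoidHom.comp_apply,
          MonoidHom.comp_apply, ← map_commutatorElement]
        exact (QuotientGroup.eq_one_iff _).2 (subset_normalClosure ⟨s, hs, t, ht, rfl⟩)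
      · rw [← MonoidHom.map_closure, hS]
        exact ⟨g, mem_top _, rfl⟩
      · rw [← MonoidHom.map_closure, hT]
        exact ⟨h, mem_top _, rfl⟩
    have hfac : (MonoidHom.noncommCoprod (q.comp inl) (q.comp inr) hcomm).comp
        Monoid.Coprod.toProd = q := by
      ext x <;> simp [inl, inr]
    intro x hx
    rw [MonoidHom.mem_ker] at hx
    rw [← QuotientGroup.eq_one_iff]
    change q x = 1
    rw [← hfac, MonoidHom.comp_apply, hx, map_one]

instance Group.IsFinitelyPresented.multiplicative_fin_int (r : ℕ) :
    Group.IsFinitelyPresented (Multiplicative (Fin r → ℤ)) := by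
  induction r with
  | zero => infer_instance
  | succ r ih =>
    let e : Multiplicative ℤ × Multiplicative (Fin r → ℤ) ≃* Multiplicative (Fin (r + 1) → ℤ) :=
      { toFun := fun x => Multiplicative.ofAdd (Fin.cons x.1.toAdd x.2.toAdd)
        invFun := fun v => (Multiplicative.ofAdd (v.toAdd 0),
          Multiplicative.ofAdd (Fin.tail v.toAdd))
        left_inv := fun x => rfl
        right_inv := fun v => congrArg Multiplicative.ofAdd (Fin.cons_self_tail v.toAdd)
        map_mul' := fun x y => by
          refine congrArg Multiplicative.ofAdd (funext fun i => ?_)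
          induction i using Fin.cases <;> rfl }
    exact Group.IsFinitelyPresented.equiv e

/-- A subdirect product of two finitely generated groups is finitely generated if its intersection
with the first factor is finitely generated as a normal subgroup of that factor. -/
theorem Subgroup.fg_of_subdirect {G H : Type*} [Group G] [Group H] [Group.FG G] [Group.FG H]
    (K : Subgroup (G × H)) (h₁ : ∀ g, ∃ h, (g, h) ∈ K) (h₂ : ∀ h, ∃ g, (g, h) ∈ K)
    (hK : (K.comap (MonoidHom.inl G H)).IsFinitelyNormallyGenerated) : K.FG := by
  obtain ⟨S, hS, hSfin⟩ := (Group.fg_iff (G := G)).1 inferInstance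
  obtain ⟨T, hT, hTfin⟩ := (Group.fg_iff (G := H)).1 inferInstance
  obtain ⟨U, hUfin, hU⟩ := hK
  choose a ha using h₁
  choose b hb using h₂
  set X : Set (G × H) := (fun g => (g, a g)) '' S ∪ (fun h => (b h, h)) '' T ∪
    MonoidHom.inl G H '' U with hX
  have hXK : closure X ≤ K := by
    rw [closure_le]
    rintro _ ((⟨g, -, rfl⟩ | ⟨h, -, rfl⟩) | ⟨u, hu, rfl⟩)
    · exact ha g
    · exact hb h
    · have : u ∈ K.comap (MonoidHom.inl G H) := hU ▸ subset_normalClosure hu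
      exact this
  refine (fg_iff _).2 ⟨X, le_antisymm hXK ?_,
    ((hSfin.image _).union (hTfin.image _)).union (hUfin.image _)⟩
  have hfst : (closure X).map (MonoidHom.fst G H) = ⊤ := by
    rw [eq_top_iff, ← hS, closure_le]
    exact fun g hg => ⟨(g, a g), subset_closure (Or.inl (Or.inl ⟨g, hg, rfl⟩)), rfl⟩
  have hsnd : (closure X).map (MonoidHom.snd G H) = ⊤ := by
    rw [eq_top_iff, ← hT, closure_le]
    exact fun h hh => ⟨(b h, h), subset_closure (Or.inl (Or.inr ⟨h, hh, rfl⟩)), rfl⟩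
  -- As `closure X` projects onto `G`, conjugation by any element of `G` is realised inside `closure
  -- X`. So the normal closure of `U` in `G` is reached from `U` alone.
  have hnormal : ((closure X).comap (MonoidHom.inl G H)).Normal := by
    refine ⟨fun n hn g => ?_⟩
    obtain ⟨x, hx, rfl⟩ := hfst ▸ mem_top g
    have : MonoidHom.inl G H (MonoidHom.fst G H x * n * (MonoidHom.fst G H x)⁻¹) =
        x * MonoidHom.inl G H n * x⁻¹ := by
      ext <;> simp
    rw [mem_comap, this]
    exact mul_mem (mul_mem hx hn) (inv_mem hx)
  have hle : K.comap (MonoidHom.inl G H) ≤ (closure X).comap (MonoidHom.inl G H) := by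
    rw [← hU]
    exact normalClosure_le_normal fun u hu => subset_closure (Or.inr ⟨u, hu, rfl⟩)
  intro k hk
  obtain ⟨x, hx, hxk⟩ := hsnd ▸ mem_top k.2
  have h1 : k * x⁻¹ = MonoidHom.inl G H (k.1 * x.1⁻¹) := by
    ext
    · simp
    · simp [← hxk]
  have h2 : k * x⁻¹ ∈ closure X := by
    rw [h1]
    refine hle ?_
    rw [mem_comap, ← h1]
    exact mul_mem hk (inv_mem (hXK hx))
  simpa using mul_mem h2 hx

end FinitelyPresented

/-! ### Hilbert's basis theorem for commuting endomorphisms. -/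

open scoped IsMulCommutative in
/-- Noetherianity of abelian groups that are finitely generated under finitely many commuting
endomorphisms. -/
theorem AddSubgroup.exists_finite_of_commuting_endomorphisms {V : Type*} [AddCommGroup V]
    {X : Set (Module.End ℤ V)} (hXfin : X.Finite) (hX : ∀ x ∈ X, ∀ y ∈ X, x * y = y * x)
    {Y : Set V} (hYfin : Y.Finite)
    (hY : ∀ W : AddSubgroup V, (∀ x ∈ X, ∀ w ∈ W, x w ∈ W) → Y ⊆ W → W = ⊤) (B : Set V) :
    ∃ B₀ ⊆ B, B₀.Finite ∧
      ∀ W : AddSubgroup V, (∀ x ∈ X, ∀ w ∈ W, x w ∈ W) → B₀ ⊆ W → B ⊆ W := by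
  let R := Algebra.adjoin ℤ X
  have : IsMulCommutative R := Algebra.isMulCommutative_adjoin ℤ hX
  have hRft : Algebra.FiniteType ℤ R :=
    (Subalgebra.fg_iff_finiteType _).1 (Subalgebra.fg_def.2 ⟨X, hXfin, rfl⟩)
  have hR : IsNoetherianRing R := Algebra.FiniteType.isNoetherianRing ℤ R
  have hfin : Module.Finite R V := by
    refine ⟨Submodule.fg_def.2 ⟨Y, hYfin, ?_⟩⟩
    refine (Submodule.toAddSubgroup_inj _ _).1 (hY _ (fun x hx w hw => ?_) Submodule.subset_span)
    exact Submodule.smul_mem (Submodule.span R Y) (⟨x, Algebra.subset_adjoin hx⟩ : R) hw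
  have hnoeth : IsNoetherian R V := isNoetherian_of_isNoetherianRing_of_finite R V
  obtain ⟨B₀, hB₀, hB₀span⟩ := (Submodule.fg_span_iff_fg_span_finset_subset B).1
    (hnoeth.noetherian (Submodule.span R B))
  refine ⟨B₀, hB₀, B₀.finite_toSet, fun W hW hB₀W => ?_⟩
  have hstable : ∀ x ∈ Algebra.adjoin ℤ X, ∀ w ∈ W, x w ∈ W := by
    intro x hx
    induction hx using Algebra.adjoin_induction with
    | mem x hx => exact hW x hx
    | algebraMap n =>
      intro w hw
      rw [Module.algebraMap_end_apply]
      exact W.zsmul_mem hw n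
    | add x y _ _ hx hy => exact fun w hw => W.add_mem (hx w hw) (hy w hw)
    | mul x y _ _ hx hy => exact fun w hw => hx _ (hy w hw)
  let W' : Submodule R V :=
    { W with smul_mem' := fun x w hw => hstable x.1 x.2 w hw }
  have : Submodule.span R B ≤ W' := by
    rw [hB₀span]
    exact Submodule.span_le.2 hB₀W
  exact fun b hb => this (Submodule.subset_span hb)

/-! ### Normal generation of central kernels. -/

section CentralKernel

open Subgroup

/-- A central extension of a free group splits, so its commutator subgroup meets the kernel
trivially. -/
theorem eq_one_of_mem_commutator_of_mem_ker {M P : Type*} [Group M] [Group P] [IsFreeGroup P]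
    (p : M →* P) (hp : Function.Surjective p) (hc : p.ker ≤ center M) {a : M}
    (ha : a ∈ commutator M) (hpa : p a = 1) : a = 1 := by
  let σ : P →* M := IsFreeGroup.lift fun x => Function.surjInv hp (IsFreeGroup.of x)
  have hσ : ∀ x, p (σ x) = x := by
    have : p.comp σ = MonoidHom.id P := by
      refine IsFreeGroup.ext_hom fun x => ?_
      simp [σ, Function.surjInv_eq]
    exact fun x => DFunLike.congr_fun this x
  have hker : ∀ m : M, m * (σ (p m))⁻¹ ∈ center M := fun m => hc (by
    rw [MonoidHom.mem_ker, map_mul, map_inv, hσ, mul_inv_cancel])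
  -- The splitting makes `m ↦ m * (σ (p m))⁻¹` a homomorphism to an abelian group; it kills
  -- commutators and fixes the kernel of `p`.
  let κ : M →* center M :=
    { toFun := fun m => ⟨m * (σ (p m))⁻¹, hker m⟩
      map_one' := by ext; simp
      map_mul' := fun m m' => by
        ext
        have := mem_center_iff.1 (hker m') (σ (p m))⁻¹
        simp only [map_mul, mul_inv_rev, coe_mul, mul_assoc] at this ⊢
        rw [this] }
  have hκ : commutator M ≤ κ.ker := by
    rw [commutator_def, commutator_le]
    intro x _ y _
    rw [MonoidHom.mem_ker, map_commutatorElement, commutatorElement_eq_one_iff_mul_comm]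
    exact Subtype.ext (mem_center_iff.1 (κ y).2 _)
  have h1 := congrArg Subtype.val (hκ ha : κ a = 1)
  simpa [κ, hpa] using h1

/-- `G` acts on the abelianisation `V` of `M` by conjugation. `N` acts trivially since it commutes
with `M`, and `M` acts trivially on its own abelianisation, so the action factors through an abelian
group and `V` is a Noetherian module. Hence the image of `π.ker` in `V` is generated by finitely
many elements. Nothing is lost in passing to `V`: `M` is a central extension of a free group, so
`π.ker` meets the commutator subgroup of `M` trivially. -/
theorem normalClosure_fg_of_central_ker {G K : Type*} [Group G] [Group K] [Group.FG G]
    (π : G →* K) (N M : Subgroup G) [N.Normal] [M.Normal]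
    (hNM : ∀ x ∈ N, ∀ y ∈ M, x * y = y * x) (hN : π.ker ≤ N) (hM : π.ker ≤ M)
    (hMfg : M.IsFinitelyNormallyGenerated) [IsFreeGroup (M.map π)]
    (hcomm : commutator G ≤ N ⊔ M) : π.ker.IsFinitelyNormallyGenerated := by
  let V := Additive (Abelianization M)
  let of : M → V := fun m => Additive.ofMul (Abelianization.of m)
  have of_mul : ∀ a b, of (a * b) = of a + of b := fun _ _ => rfl
  have of_inv : ∀ a, of a⁻¹ = -of a := fun _ => rfl
  have of_one : of 1 = 0 := rfl
  let conj : G →* MulAut M := MulAut.conjNormal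
  let ρ : G →* Module.End ℤ V :=
    { toFun := fun x => (MonoidHom.toAdditive
        (Abelianization.map (conj x).toMonoidHom)).toIntLinearMap
      map_one' := by
        ext v
        induction v using Additive.rec with | _ v
        induction v using QuotientGroup.induction_on with | _ v
        rw [map_one]
        rfl
      map_mul' := fun x y => by
        ext v
        induction v using Additive.rec with | _ v
        induction v using QuotientGroup.induction_on with | _ v
        rw [map_mul]
        rfl }
  have hρ : ∀ x m, ρ x (of m) = of (conj x m) := fun _ _ => rfl
  have of_surj : ∀ v : V, ∃ m, of m = v := fun v => by
    induction v using Additive.rec with | _ v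
    induction v using QuotientGroup.induction_on with | _ v
    exact ⟨v, rfl⟩
  have hρker : N ⊔ M ≤ ρ.ker := by
    refine sup_le (fun x hx => ?_) (fun x hx => ?_)
    · refine LinearMap.ext fun v => ?_
      obtain ⟨m, rfl⟩ := of_surj v
      rw [hρ, Module.End.one_apply]
      refine congrArg of (Subtype.ext ?_)
      rw [MulAut.conjNormal_apply, hNM x hx m m.2, mul_inv_cancel_right]
    · refine LinearMap.ext fun v => ?_
      obtain ⟨m, rfl⟩ := of_surj v
      rw [hρ, Module.End.one_apply]
      have : conj x m = ⟨x, hx⟩ * m * ⟨x, hx⟩⁻¹ := Subtype.ext (MulAut.conjNormal_apply x m)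
      rw [this, of_mul, of_mul, of_inv]
      abel
  have hρcomm : ∀ x y, ρ x * ρ y = ρ y * ρ x := fun x y => by
    have h1 : ρ ⁅x, y⁆ = 1 := hρker (hcomm (commutator_mem_commutator (mem_top x) (mem_top y)))
    rw [← map_mul, ← map_mul, ← one_mul (ρ (y * x)), ← h1, ← map_mul]
    congr 1
    simp [commutatorElement_def, mul_assoc]
  obtain ⟨S, hS, hSfin⟩ := (Group.fg_iff (G := G)).1 inferInstance
  -- Inverses are included so that an `X`-stable subgroup is stable under all of `G`.
  let X : Set (Module.End ℤ V) := ρ '' (S ∪ S⁻¹)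
  have hstable : ∀ W : AddSubgroup V, (∀ x ∈ X, ∀ w ∈ W, x w ∈ W) →
      ∀ g, ∀ w ∈ W, ρ g w ∈ W := by
    intro W hW g
    have hg : g ∈ closure S := hS ▸ mem_top g
    induction hg using closure_induction'' with
    | mem x hx => exact hW _ ⟨x, Or.inl hx, rfl⟩
    | inv_mem x hx => exact hW _ ⟨x⁻¹, Or.inr (Set.inv_mem_inv.2 hx), rfl⟩
    | one => intro w hw; rw [map_one]; exact hw
    | mul x y _ _ hx hy => intro w hw; rw [map_mul]; exact hx _ (hy w hw)
  have hXfin : X.Finite := (hSfin.union hSfin.inv).image _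
  obtain ⟨Y, hYfin, hY⟩ := hMfg
  have hYM : Y ⊆ M := hY ▸ subset_normalClosure
  obtain ⟨B₀, hB₀, hB₀fin, hB₀W⟩ := AddSubgroup.exists_finite_of_commuting_endomorphisms hXfin
    (by rintro _ ⟨x, -, rfl⟩ _ ⟨y, -, rfl⟩; exact hρcomm x y)
    (Y := of '' (Subtype.val ⁻¹' Y)) ((hYfin.preimage Subtype.val_injective.injOn).image _)
    (fun W hW hYW => by
      have h1 := hstable W hW
      let W' : Subgroup G := ((AddSubgroup.toSubgroup W).comap Abelianization.of).map M.subtype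
      have hW' : W'.Normal := by
        refine ⟨?_⟩
        rintro _ ⟨m, hm, rfl⟩ x
        exact ⟨conj x m, h1 x _ hm, MulAut.conjNormal_apply x m⟩
      have hle : M ≤ W' := by
        rw [← hY]
        exact normalClosure_le_normal fun y hy =>
          ⟨⟨y, hYM hy⟩, hYW ⟨⟨y, hYM hy⟩, hy, rfl⟩, rfl⟩
      rw [eq_top_iff]
      rintro v -
      obtain ⟨m, rfl⟩ := of_surj v
      obtain ⟨m', hm', h⟩ := hle m.2
      rw [← (Subtype.ext h : m' = m)]
      exact hm')
    (of '' (Subtype.val ⁻¹' (π.ker : Set G)))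
  choose! a ha using fun v (hv : v ∈ B₀) => hB₀ hv
  refine ⟨(fun v => (a v : G)) '' B₀, hB₀fin.image _, le_antisymm ?_ ?_⟩
  · refine normalClosure_le_normal ?_
    rintro _ ⟨v, hv, rfl⟩
    exact (ha v hv).1
  set D := normalClosure ((fun v => (a v : G)) '' B₀) with hD
  have hDker : D ≤ π.ker := by
    refine normalClosure_le_normal ?_
    rintro _ ⟨v, hv, rfl⟩
    exact (ha v hv).1
  let W : AddSubgroup V := Subgroup.toAddSubgroup ((D.subgroupOf M).map Abelianization.of)
  have hW : of '' (Subtype.val ⁻¹' (π.ker : Set G)) ⊆ W := by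
    refine hB₀W W ?_ ?_
    · rintro _ ⟨x, -, rfl⟩ _ ⟨d, hd, rfl⟩
      refine ⟨conj x d, ?_, rfl⟩
      change (conj x d : G) ∈ D
      rw [MulAut.conjNormal_apply]
      exact normalClosure_normal.conj_mem _ hd x
    · intro v hv
      exact ⟨a v, subset_normalClosure ⟨v, hv, rfl⟩, (ha v hv).2⟩
  intro g hg
  obtain ⟨d, hd, hdg⟩ := hW ⟨⟨g, hM hg⟩, hg, rfl⟩
  let p : M →* M.map π := π.subgroupMap M
  have hpker : ∀ m : M, p m = 1 ↔ (m : G) ∈ π.ker := fun m => by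
    rw [Subtype.ext_iff, MonoidHom.mem_ker]
    rfl
  have h1 : (⟨g, hM hg⟩ : M) * d⁻¹ = 1 := by
    refine eq_one_of_mem_commutator_of_mem_ker p (π.subgroupMap_surjective M) ?_ ?_ ?_
    · intro m hm
      rw [mem_center_iff]
      exact fun x => Subtype.ext (hNM m (hN ((hpker m).1 hm)) x x.2).symm
    · rw [← Abelianization.ker_of, MonoidHom.mem_ker, map_mul, map_inv, mul_inv_eq_one]
      exact hdg.symm
    · rw [hpker]
      exact mul_mem hg (inv_mem (hDker hd))
  rw [mul_inv_eq_one] at h1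
  have h2 : g = d := congrArg Subtype.val h1
  rw [h2]
  exact hd

end CentralKernel

/-! ### Finite presentation of subdirect products. -/

section Subdirect

open Subgroup

theorem Group.fg_of_ker_fg {K Q : Type*} [Group K] [Group Q] [Group.FG Q] (f : K →* Q)
    (hf : Function.Surjective f) (hker : f.ker.FG) : Group.FG K := by
  obtain ⟨S, hS, hSfin⟩ := (Subgroup.fg_iff _).1 hker
  obtain ⟨T, hT, hTfin⟩ := (Group.fg_iff (G := Q)).1 inferInstance
  refine Group.fg_iff.2 ⟨S ∪ Function.surjInv hf '' T, ?_, hSfin.union (hTfin.image _)⟩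
  have hmap : (closure (S ∪ Function.surjInv hf '' T)).map f = ⊤ := by
    rw [eq_top_iff, ← hT, closure_le]
    exact fun t ht => ⟨_, subset_closure (Or.inr ⟨t, ht, rfl⟩), Function.surjInv_eq hf t⟩
  have hle : f.ker ≤ closure (S ∪ Function.surjInv hf '' T) := by
    rw [← hS]
    exact closure_mono Set.subset_union_left
  rw [← sup_eq_left.2 hle, ← comap_map_eq, hmap, comap_top]

/-- Both `t` and `t⁻¹` are needed, since a subgroup can be conjugated properly into itself. -/
theorem Subgroup.normal_closure_of_conj_mem {G : Type*} [Group G] {S T : Set G}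
    (hT : closure T = ⊤)
    (h : ∀ t ∈ T, ∀ s ∈ S, t * s * t⁻¹ ∈ closure S ∧ t⁻¹ * s * t ∈ closure S) :
    (closure S).Normal := by
  rw [← normalizer_eq_top_iff, eq_top_iff, ← hT, closure_le]
  have hconj : ∀ t : G, (∀ s ∈ S, t * s * t⁻¹ ∈ closure S) →
      ∀ x ∈ closure S, t * x * t⁻¹ ∈ closure S := by
    intro t ht
    have : closure S ≤ (closure S).comap (MulAut.conj t).toMonoidHom := by
      rw [closure_le]
      exact ht
    exact this
  intro t ht
  refine mem_normalizer_iff.2 fun x => ⟨hconj t (fun s hs => (h t ht s hs).1) x, fun hx => ?_⟩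
  have := hconj t⁻¹ (fun s hs => by rw [inv_inv]; exact (h t ht s hs).2) _ hx
  simpa [mul_assoc] using this

/-- A subdirect product of a free group and a finitely presented group is finitely presented if its
intersection with the second factor is finitely generated and the quotient by the intersections with
the factors is abelian. -/
theorem Group.IsFinitelyPresented.of_subdirect {K F Q : Type*} [Group K] [Group F] [Group Q]
    [IsFreeGroup F] [Group.IsFinitelyPresented F] [Group.IsFinitelyPresented Q]
    (f : K →* F) (hf : Function.Surjective f) (g : K →* Q) (hg : Function.Surjective g)
    (hfg : f.ker ⊓ g.ker = ⊥) (hker : f.ker.FG) (hcomm : _root_.commutator K ≤ f.ker ⊔ g.ker) :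
    Group.IsFinitelyPresented K := by
  have hKfg : Group.FG K := Group.fg_of_ker_fg f hf hker
  obtain ⟨α, hα, π, hπ⟩ := Group.fg_iff_exists_freeGroup_hom_surjective_finite.1 hKfg
  have hfree : Group.IsFinitelyPresented (FreeGroup α) := inferInstance
  obtain ⟨X, hX, hXfin⟩ := (Group.fg_iff (G := FreeGroup α)).1 inferInstance
  obtain ⟨S', hS', hS'fin⟩ := (Subgroup.fg_iff _).1 hker
  obtain ⟨T, hTfin, hT⟩ := isFinitelyNormallyGenerated_ker (f.comp π) (hf.comp hπ)
  obtain ⟨Y, hYfin, hY⟩ := isFinitelyNormallyGenerated_ker (g.comp π) (hg.comp hπ)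
  let S : Set (FreeGroup α) := Function.surjInv hπ '' S'
  have hSfin : S.Finite := hS'fin.image _
  have hS : (closure S).map π = f.ker := by
    rw [MonoidHom.map_closure, ← hS']
    congr 1
    ext x
    simp [S, Function.surjInv_eq]
  have hSf : ∀ s ∈ S, π s ∈ f.ker := fun s hs => hS ▸ ⟨s, subset_closure hs, rfl⟩
  have hYg : ∀ y ∈ Y, π y ∈ g.ker := fun y hy => by
    have : y ∈ (g.comp π).ker := hY ▸ subset_normalClosure hy
    exact this
  have hTf : ∀ t ∈ T, π t ∈ f.ker := fun t ht => by
    have : t ∈ (f.comp π).ker := hT ▸ subset_normalClosure ht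
    exact this
  have hw : ∀ x : FreeGroup α, ∃ w, π x ∈ f.ker → w ∈ closure S ∧ π w = π x := fun x => by
    by_cases hx : π x ∈ f.ker
    · obtain ⟨w, hw⟩ := hS.symm ▸ hx
      exact ⟨w, fun _ => hw⟩
    · exact ⟨1, fun h => absurd h hx⟩
  choose w hw using hw
  let Z : Set (FreeGroup α) := Set.image2 (fun x s => x * s * x⁻¹) X S ∪
    Set.image2 (fun x s => x⁻¹ * s * x) X S ∪ T
  have hZfin : Z.Finite := ((hXfin.image2 _ hSfin).union (hXfin.image2 _ hSfin)).union hTfin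
  have hZf : ∀ z ∈ Z, π z ∈ f.ker := by
    have hn : f.ker.Normal := inferInstance
    rintro _ ((⟨x, -, s, hs, rfl⟩ | ⟨x, -, s, hs, rfl⟩) | ht)
    · rw [map_mul, map_mul, map_inv]
      exact hn.conj_mem _ (hSf s hs) _
    · rw [map_mul, map_mul, map_inv]
      exact hn.conj_mem' _ (hSf s hs) _
    · exact hTf _ ht
  -- The first relators rewrite each element of `Z` as a word in `S`: this makes `closure S` normal
  -- in the quotient and puts the kernel of the map to `F` inside it. The second make it commute
  -- with the normal closure of `Y`.
  let D : Set (FreeGroup α) := (fun z => z * (w z)⁻¹) '' Z ∪ Set.image2 (fun s y => ⁅s, y⁆) S Y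
  have hDfin : D.Finite := (hZfin.image _).union (hSfin.image2 _ hYfin)
  have hDπ : normalClosure D ≤ π.ker := by
    refine normalClosure_le_normal ?_
    rintro _ (⟨z, hz, rfl⟩ | ⟨s, hs, y, hy, rfl⟩)
    · change π (z * (w z)⁻¹) = 1
      rw [map_mul, map_inv, (hw z (hZf z hz)).2, mul_inv_cancel]
    · change π ⁅s, y⁆ = 1
      rw [map_commutatorElement, ← mem_bot, ← hfg]
      exact commutator_le_inf _ _ (commutator_mem_commutator (hSf s hs) (hYg y hy))
  let q := QuotientGroup.mk' (normalClosure D)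
  have hq : Function.Surjective q := QuotientGroup.mk'_surjective _
  let π' : FreeGroup α ⧸ normalClosure D →* K := QuotientGroup.lift _ π hDπ
  have hπ'q : ∀ x, π' (q x) = π x := fun _ => rfl
  have hπ' : Function.Surjective π' := fun k => by
    obtain ⟨x, rfl⟩ := hπ k
    exact ⟨q x, rfl⟩
  have hG : Group.IsFinitelyPresented (FreeGroup α ⧸ normalClosure D) :=
    quotient _ ⟨D, hDfin, rfl⟩
  have hZq : ∀ z ∈ Z, q z ∈ closure (q '' S) := fun z hz => by
    have h1 : q z = q (w z) := by
      rw [← mul_inv_eq_one, ← map_inv, ← map_mul]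
      exact (QuotientGroup.eq_one_iff _).2 (subset_normalClosure (Or.inl ⟨z, hz, rfl⟩))
    rw [h1, ← MonoidHom.map_closure]
    exact ⟨_, (hw z (hZf z hz)).1, rfl⟩
  have hN : (closure (q '' S)).Normal := by
    refine normal_closure_of_conj_mem (T := q '' X) ?_ ?_
    · rw [← MonoidHom.map_closure, hX, map_top_of_surjective _ hq]
    · rintro _ ⟨x, hx, rfl⟩ _ ⟨s, hs, rfl⟩
      simp only [← map_mul, ← map_inv]
      exact ⟨hZq _ (Or.inl (Or.inl ⟨x, hx, s, hs, rfl⟩)),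
        hZq _ (Or.inl (Or.inr ⟨x, hx, s, hs, rfl⟩))⟩
  have hNM : ∀ x ∈ closure (q '' S), ∀ y ∈ normalClosure (q '' Y), x * y = y * x := by
    have : normalClosure (q '' Y) ≤ centralizer (closure (q '' S) : Set _) := by
      refine normalClosure_le_normal ?_
      rintro _ ⟨y, hy, rfl⟩
      rw [centralizer_closure, SetLike.mem_coe, mem_centralizer_iff]
      rintro _ ⟨s, hs, rfl⟩
      rw [← commutatorElement_eq_one_iff_mul_comm, ← map_commutatorElement]
      exact (QuotientGroup.eq_one_iff _).2 (subset_normalClosure (Or.inr ⟨s, hs, y, hy, rfl⟩))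
    exact fun x hx y hy => mem_centralizer_iff.1 (this hy) x hx
  have hkerN : π'.ker ≤ closure (q '' S) := by
    intro v hv
    obtain ⟨x, rfl⟩ := hq v
    have hx : x ∈ normalClosure T := by
      rw [hT, MonoidHom.mem_ker, MonoidHom.comp_apply, ← hπ'q, (hv : π' (q x) = 1), map_one]
    exact (normalClosure_le_normal (N := (closure (q '' S)).comap q)
      fun t ht => hZq t (Or.inr ht)) hx
  have hkerM : π'.ker ≤ normalClosure (q '' Y) := by
    intro v hv
    obtain ⟨x, rfl⟩ := hq v
    have hx : x ∈ normalClosure Y := by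
      rw [hY, MonoidHom.mem_ker, MonoidHom.comp_apply, ← hπ'q, (hv : π' (q x) = 1), map_one]
    exact (normalClosure_le_normal (N := (normalClosure (q '' Y)).comap q)
      fun y hy => subset_normalClosure ⟨y, hy, rfl⟩) hx
  have hmapN : (closure (q '' S)).map π' = f.ker := by
    rw [← MonoidHom.map_closure, map_map, ← hS]
    rfl
  have hmapM : (normalClosure (q '' Y)).map π' = g.ker := by
    rw [map_normalClosure _ _ hπ', ← map_comap_eq_self_of_surjective hπ g.ker,
      MonoidHom.comap_ker, ← hY, map_normalClosure _ _ hπ, ← Set.image_comp]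
    rfl
  -- `f` embeds `g.ker` in the free group `F`, and subgroups of free groups are free.
  have hgfree : IsFreeGroup ((normalClosure (q '' Y)).map π') := by
    rw [hmapM]
    have hinj : Function.Injective (f.comp g.ker.subtype) := by
      rw [injective_iff_map_eq_one]
      intro x hx
      have : (x : K) ∈ f.ker ⊓ g.ker := ⟨hx, x.2⟩
      rw [hfg] at this
      exact Subtype.ext this
    exact IsFreeGroup.ofMulEquiv (MonoidHom.ofInjective hinj).symm
  refine of_surjective π' hπ' (normalClosure_fg_of_central_ker π' (closure (q '' S))
    (normalClosure (q '' Y)) hNM hkerN hkerM ⟨_, hYfin.image _, rfl⟩ ?_)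
  -- The join contains `π'.ker`, so the inclusion can be checked after mapping to `K`, where it is
  -- `hcomm`.
  rw [← sup_eq_left.2 (hkerN.trans (le_sup_left (b := normalClosure (q '' Y)))), ← comap_map_eq,
    Subgroup.map_sup, hmapN, hmapM, ← map_le_iff_le_comap]
  refine le_trans ?_ hcomm
  rw [_root_.commutator_def, _root_.commutator_def, map_commutator]
  exact commutator_mono le_top le_top

end Subdirect

/-! ### Finite presentation of `ker ψ`. -/

theorem isFinitelyPresented_ker {r : ℕ}
    (ψ : (Fin 3 → FreeGroup (Fin r)) →* Multiplicative (Fin r → ℤ))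
    (hψ : FactorwiseSurjective ψ) : Group.IsFinitelyPresented ψ.ker := by
  have hψ' : ∀ k v, ∃ a : FreeGroup (Fin r), ψ (Pi.mulSingle k a) = v := fun k v => hψ k v
  let F := FreeGroup (Fin r)
  let f : ψ.ker →* F := (Pi.evalMonoidHom (fun _ : Fin 3 => F) 2).comp ψ.ker.subtype
  let g : ψ.ker →* F × F := ((Pi.evalMonoidHom (fun _ : Fin 3 => F) 0).prod
    (Pi.evalMonoidHom (fun _ : Fin 3 => F) 1)).comp ψ.ker.subtype
  let ι : F × F →* (Fin 3 → F) := MonoidHom.noncommCoprod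
    (MonoidHom.mulSingle (fun _ : Fin 3 => F) 0) (MonoidHom.mulSingle (fun _ : Fin 3 => F) 1)
    fun a b => Pi.mulSingle_commute (f := fun _ : Fin 3 => F) zero_ne_one a b
  have hι : ∀ x, ι x = Pi.mulSingle 0 x.1 * Pi.mulSingle 1 x.2 := fun _ => rfl
  have hf : Function.Surjective f := fun c => by
    obtain ⟨a, ha⟩ := hψ' 0 (ψ (Pi.mulSingle 2 c))⁻¹
    exact ⟨⟨Pi.mulSingle 0 a * Pi.mulSingle 2 c, by
      rw [MonoidHom.mem_ker, map_mul, ha, inv_mul_cancel]⟩, by simp [f]⟩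
  have hg : Function.Surjective g := fun x => by
    obtain ⟨c, hc⟩ := hψ' 2 (ψ (ι x))⁻¹
    exact ⟨⟨ι x * Pi.mulSingle 2 c, by
      rw [MonoidHom.mem_ker, map_mul, hc, mul_inv_cancel]⟩, by simp [g, hι]⟩
  -- `f.ker` is the kernel `H` of `ψ` on the first two factors. `H` is subdirect and meets the first
  -- factor in the kernel of a map onto `ℤ ^ r`, which is finitely normally generated because `ℤ ^
  -- r` is finitely presented.
  have hker : f.ker.FG := by
    let H : Subgroup (F × F) := (ψ.comp ι).ker
    have hH : H.FG := by
      refine H.fg_of_subdirect (fun a => ?_) (fun b => ?_) ?_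
      · obtain ⟨b, hb⟩ := hψ' 1 (ψ (Pi.mulSingle 0 a))⁻¹
        refine ⟨b, ?_⟩
        rw [MonoidHom.mem_ker, MonoidHom.comp_apply, hι, map_mul, hb, mul_inv_cancel]
      · obtain ⟨a, ha⟩ := hψ' 0 (ψ (Pi.mulSingle 1 b))⁻¹
        refine ⟨a, ?_⟩
        rw [MonoidHom.mem_ker, MonoidHom.comp_apply, hι, map_mul, ha, inv_mul_cancel]
      · have : H.comap (MonoidHom.inl F F) =
            (ψ.comp (MonoidHom.mulSingle (fun _ : Fin 3 => F) 0)).ker := by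
          ext a
          simp [H, hι, MonoidHom.mem_ker]
        rw [this]
        exact Group.IsFinitelyPresented.isFinitelyNormallyGenerated_ker _ (hψ 0)
    have hHG : Group.FG H := (Group.fg_iff_subgroup_fg H).2 hH
    let j : H →* ψ.ker := (ι.comp H.subtype).codRestrict ψ.ker fun x => x.2
    have hj : j.range = f.ker := by
      refine le_antisymm ?_ fun k hk => ?_
      · rintro _ ⟨x, rfl⟩
        change ι x.1 2 = 1
        simp [hι]
      · have hk2 : k.1 2 = 1 := hk
        have h1 : k.1 = ι (k.1 0, k.1 1) := by
          rw [hι, eq_mulSingle_mul_mulSingle_mul_mulSingle k.1, hk2]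
          simp
        refine ⟨⟨(k.1 0, k.1 1), ?_⟩, Subtype.ext h1.symm⟩
        rw [MonoidHom.mem_ker, MonoidHom.comp_apply, ← h1]
        exact k.2
    rw [← hj, ← Group.fg_iff_subgroup_fg]
    exact Group.fg_range j
  refine Group.IsFinitelyPresented.of_subdirect f hf g hg ?_ hker ?_
  · rw [eq_bot_iff]
    rintro k ⟨h1, h2⟩
    have h2' : k.1 2 = 1 := h1
    have h0' : k.1 0 = 1 := congrArg Prod.fst (h2 : g k = 1)
    have h1' : k.1 1 = 1 := congrArg Prod.snd (h2 : g k = 1)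
    refine Subtype.ext ?_
    rw [eq_mulSingle_mul_mulSingle_mul_mulSingle k.1, h0', h1', h2']
    simp
  · rw [_root_.commutator_def, Subgroup.commutator_le]
    intro k _ l _
    -- The target of `ψ` is abelian, so each coordinate of a commutator lies in `ker ψ` by itself;
    -- splitting off the last one separates `f.ker` from `g.ker`.
    have hmem : (Pi.mulSingle 2 ⁅k.1 2, l.1 2⁆ : Fin 3 → F) ∈ ψ.ker := by
      rw [MonoidHom.mem_ker, ← MonoidHom.mulSingle_apply, map_commutatorElement,
        map_commutatorElement, commutatorElement_eq_one_iff_mul_comm, mul_comm]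
    have h1 : ⁅k, l⁆ = ⁅k, l⁆ * ⟨_, hmem⟩⁻¹ * ⟨_, hmem⟩ := by group
    rw [h1]
    have hkl : f ⁅k, l⁆ = ⁅k.1 2, l.1 2⁆ := map_commutatorElement f k l
    refine Subgroup.mul_mem_sup ?_ ?_
    · rw [MonoidHom.mem_ker, map_mul, hkl, map_inv, mul_inv_eq_one]
      simp [f]
    · rw [MonoidHom.mem_ker]
      simp [g]

theorem mainTheorem7 (r : ℕ) (hr : 2 ≤ r)
    (ψ : (Fin 3 → FreeGroup (Fin r)) →* Multiplicative (Fin r → ℤ))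
    (hψ : FactorwiseSurjective ψ) :
    Group.IsFinitelyPresented ψ.ker ∧
      ∀ P : FiniteGroupPresentation ψ.ker, AsympLE (fun N => N ^ 4) P.dehn :=
  ⟨isFinitelyPresented_ker ψ hψ, asympLE_dehn_ker hr ψ hψ⟩
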